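/- Let $n\in\mathbb N$ and let $1<\alpha<n$ (so $n\ge 2$). Write $\mathbb R^n_+=\{x=(x',x_n)\in\mathbb R^{n-1}\times\mathbb R: x_n>0\}$ and $\partial\mathbb R^n_+=\mathbb R^{n-1}$, both with Lebesgue measure, and $|x-y|=\sqrt{|x'-y|^2+x_n^2}$ for $x\in\mathbb R^n_+$, $y\in\partial\mathbb R^n_+$. Let $1<p,t<\infty$ satisfy $$\frac{n-1}{n}\cdot\frac1p+\frac1t+\frac{n-\alpha+1}{n}=2 ,$$ define $q$ by $\frac1q=\frac{n-1}{n}\left(\frac1p-\frac{\alpha-1}{n-1}\right)$, and put $$E_\alpha f(x)=\int_{\partial\mathbb R^n_+}\frac{f(y)}{|x-y|^{n-\alpha}}\,dy,\qquad C_e(n,\alpha,p)=\sup\left\{\|E_\alpha f\|_{L^q(\mathbb R^n_+)}: f\in L^p(\partial\mathbb R^n_+),\ \|f\|_{L^p(\partial\mathbb R^n_+)}=1\right\},$$ all functions being real-valued. Then $0<C_e(n,\alpha,p)<\infty$, and for all $f\in L^p(\partial\mathbb R^n_+)$ and $g\in L^t(\mathbb R^n_+)$ the double integral below converges absolutely and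 $$\int_{\mathbb R^n_+}\int_{\partial\mathbb R^n_+}\frac{g(x)f(y)}{|x-y|^{n-\alpha}}\,dy\,dx\le C_e(n,\alpha,p)\,\|f\|_{L^p(\partial\mathbb R^n_+)}\,\|g\|_{L^t(\mathbb R^n_+)} .$$ The inequality is sharp: if it holds for all such $f,g$ with a real constant $C$ in place of $C_e(n,\alpha,p)$, then $C\ge C_e(n,\alpha,p)$. Moreover, for every $C\ge0$, it holds for all such $f,g$ with $C$ in place of $C_e(n,\alpha,p)$ if and only if $\|E_\alpha f\|_{L^q(\mathbb R^n_+)}\le C\|f\|_{L^p(\partial\mathbb R^n_+)}$ for all $f\in L^p(\partial\mathbb R^n_+)$. -/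

import Mathlib

open MeasureTheory
open scoped ENNReal

noncomputable section

namespace HalfSpaceHLS

/-- The boundary `∂ℝⁿ₊ = ℝⁿ⁻¹`, with its Euclidean norm and Lebesgue measure. -/
abbrev Boundary (n : ℕ) : Type := EuclideanSpace ℝ (Fin (n - 1))

/-- `ℝⁿ` in the coordinates `x = (x', xₙ)` with `x' ∈ ℝⁿ⁻¹` and `xₙ ∈ ℝ` (for `n ≥ 1`).
Only the product (Lebesgue) measure of this type is used; Euclidean distances are
written out in `bdist`. -/
abbrev Ambient (n : ℕ) : Type := Boundary n × ℝ

/-- The open upper half space `ℝⁿ₊ = {(x', xₙ) : xₙ > 0}`. -/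
def halfSpace (n : ℕ) : Set (Ambient n) := {x | 0 < x.2}

/-- Lebesgue measure on the upper half space. -/
def halfVol (n : ℕ) : Measure (Ambient n) := volume.restrict (halfSpace n)

/-- The Euclidean distance `|x - y| = √(|x' - y|² + xₙ²)` between `x = (x', xₙ)` and the
boundary point `y`, identified with `(y, 0)`. -/
def bdist {n : ℕ} (x : Ambient n) (y : Boundary n) : ℝ :=
  √(‖x.1 - y‖ ^ 2 + x.2 ^ 2)

/-- The extension operator `E_α f (x) = ∫_{∂ℝⁿ₊} f(y) / |x - y|^(n - α) dy`. -/
def extOp (n : ℕ) (α : ℝ) (f : Boundary n → ℝ) (x : Ambient n) : ℝ :=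
  ∫ y, f y / bdist x y ^ ((n : ℝ) - α)

/-- The exponent `q` with `1/q = (n-1)/n * (1/p - (α-1)/(n-1))`. -/
def qExp (n : ℕ) (α p : ℝ) : ℝ :=
  (((n : ℝ) - 1) / n * (1 / p - (α - 1) / ((n : ℝ) - 1)))⁻¹

/-- The best constant
`C_e(n,α,p) = sup {‖E_α f‖_{L^q(ℝⁿ₊)} : f ∈ L^p(∂ℝⁿ₊), ‖f‖_{L^p(∂ℝⁿ₊)} = 1}`,
a priori an element of `[0, ∞]`. -/
def Ce (n : ℕ) (α p : ℝ) : ℝ≥0∞ :=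
  sSup {c | ∃ f : Boundary n → ℝ, MemLp f (ENNReal.ofReal p) volume ∧
    eLpNorm f (ENNReal.ofReal p) volume = 1 ∧
    c = eLpNorm (extOp n α f) (ENNReal.ofReal (qExp n α p)) (halfVol n)}

/-- The bilinear inequality with constant `C`:
`∫_{ℝⁿ₊} ∫_{∂ℝⁿ₊} g(x) f(y) / |x - y|^(n-α) dy dx ≤ C ‖f‖_{L^p} ‖g‖_{L^t}`
for all `f ∈ L^p(∂ℝⁿ₊)` and `g ∈ L^t(ℝⁿ₊)`. -/
def BilinearHLS (n : ℕ) (α p t C : ℝ) : Prop :=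
  ∀ (f : Boundary n → ℝ) (g : Ambient n → ℝ),
    MemLp f (ENNReal.ofReal p) volume → MemLp g (ENNReal.ofReal t) (halfVol n) →
    ∫ x, (∫ y, g x * f y / bdist x y ^ ((n : ℝ) - α)) ∂(halfVol n) ≤
      C * (eLpNorm f (ENNReal.ofReal p) volume).toReal *
        (eLpNorm g (ENNReal.ofReal t) (halfVol n)).toReal

/-- The operator inequality with constant `C`:
`‖E_α f‖_{L^q(ℝⁿ₊)} ≤ C ‖f‖_{L^p(∂ℝⁿ₊)}` for all `f ∈ L^p(∂ℝⁿ₊)`. -/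
def ExtensionHLS (n : ℕ) (α p C : ℝ) : Prop :=
  ∀ f : Boundary n → ℝ, MemLp f (ENNReal.ofReal p) volume →
    eLpNorm (extOp n α f) (ENNReal.ofReal (qExp n α p)) (halfVol n) ≤
      ENNReal.ofReal C * eLpNorm f (ENNReal.ofReal p) volume

end HalfSpaceHLS

end

/-! The exponent relation says exactly that `t` and `q` are conjugate (`holderConjugate_qExp`).
Hölder's inequality turns an operator bound into a bilinear bound with the same constant, and
testing with `g = h|h|^(q-2)`, `h = E_α f`, turns it back once `‖h‖_q` is known to be finite.
Sharpness follows, because `Ce` is by definition the best constant in the operator bound. What needs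
analysis is `Ce < ∞`.

For finiteness only the level sets of the kernel matter. With `l = n - α`, the set where `|x -
y|^(-l) > τ` lies within distance `τ^(-1/l)`, so the kernel is uniformly of weak type `n/l` in `x`
and `(n-1)/l` in `y`. `exists_lintegral_lintegral_le_of_weakType` derives the inequality from these
two facts alone. For normalized `f, g ≥ 0` the product space is cut along `f(y) = g(x)^κ`; on each
side one integrates first in the variable whose function is bounded by a power of the other one. The
level estimate `setLIntegral_le_mul_le_of_weakType` then leaves a multiple of `∫ g^t` on one side
and of `∫ f^p` on the other. One `κ` serves both sides precisely because the exponents balance.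

Positivity of `Ce` comes from the indicator of a ball. -/

/-! ### Level-set estimates for functions of weak type. -/

section WeakType

variable {X : Type*} [MeasurableSpace X]

theorem lintegral_Ioc_zero_ofReal_rpow {r τ : ℝ} (hr : -1 < r) (hτ : 0 ≤ τ) :
    ∫⁻ u in Set.Ioc 0 τ, ENNReal.ofReal (u ^ r) = ENNReal.ofReal (τ ^ (r + 1) / (r + 1)) := by
  have hint : IntegrableOn (fun u : ℝ => u ^ r) (Set.Ioc 0 τ) :=
    (intervalIntegrable_iff_integrableOn_Ioc_of_le hτ).1 (intervalIntegral.intervalIntegrable_rpow' hr)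
  rw [← ofReal_integral_eq_lintegral_ofReal hint
    ((ae_restrict_iff' measurableSet_Ioc).2 (.of_forall fun u hu => Real.rpow_nonneg hu.1.le _)),
    ← intervalIntegral.integral_of_le hτ, integral_rpow (Or.inl hr),
    Real.zero_rpow (by linarith), sub_zero]

theorem lintegral_Ioi_ofReal_rpow {r τ : ℝ} (hr : r < -1) (hτ : 0 < τ) :
    ∫⁻ u in Set.Ioi τ, ENNReal.ofReal (u ^ r) = ENNReal.ofReal (-τ ^ (r + 1) / (r + 1)) := by
  rw [← ofReal_integral_eq_lintegral_ofReal (integrableOn_Ioi_rpow_of_lt hr hτ)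
    ((ae_restrict_iff' measurableSet_Ioi).2
      (.of_forall fun u hu => Real.rpow_nonneg (hτ.trans hu).le _)),
    integral_Ioi_rpow_of_lt hr hτ]

/-- A nonnegative function of weak type `σ > 1` is integrable where it is large. -/
theorem setLIntegral_gt_le_of_weakType {μ : Measure X} {h : X → ℝ} (hm : Measurable h)
    (h0 : ∀ x, 0 ≤ h x) {A : ℝ≥0∞} {σ : ℝ} (hσ : 1 < σ)
    (hw : ∀ τ, 0 < τ → μ {x | τ < h x} ≤ A * ENNReal.ofReal (τ ^ (-σ))) {τ : ℝ} (hτ : 0 < τ) :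
    ∫⁻ x in {x | τ < h x}, ENNReal.ofReal (h x) ∂μ ≤
      A * ENNReal.ofReal (σ / (σ - 1)) * ENNReal.ofReal (τ ^ (1 - σ)) := by
  have key := lintegral_rpow_eq_lintegral_meas_lt_mul (μ.restrict {x | τ < h x})
    (.of_forall h0) hm.aemeasurable one_pos
  simp only [Real.rpow_one, sub_self, Real.rpow_zero, ENNReal.ofReal_one, one_mul, mul_one] at key
  rw [key, ← Set.Ioc_union_Ioi_eq_Ioi hτ.le,
    lintegral_union measurableSet_Ioi (Set.Ioc_disjoint_Ioi le_rfl)]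
  -- Below height `τ` the level sets of the restricted function are all bounded by `{τ < h}`; above
  -- it the weak-type tail is integrated. The factors `1` and `1/(σ-1)` add up to `σ/(σ-1)`.
  have h1 : ∫⁻ u in Set.Ioc 0 τ, μ.restrict {x | τ < h x} {x | u < h x} ≤
      A * ENNReal.ofReal (τ ^ (1 - σ)) := by
    calc _ ≤ ∫⁻ u in Set.Ioc 0 τ, A * ENNReal.ofReal (τ ^ (-σ)) := by
          refine lintegral_mono fun u => ?_
          refine (measure_mono (Set.subset_univ _)).trans ?_
          rw [Measure.restrict_apply_univ]
          exact hw τ hτ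
      _ = A * ENNReal.ofReal (τ ^ (1 - σ)) := by
          rw [setLIntegral_const, Real.volume_Ioc, sub_zero, mul_assoc,
            ← ENNReal.ofReal_mul (by positivity)]
          congr 2
          rw [sub_eq_add_neg, add_comm, Real.rpow_add hτ, Real.rpow_one]
  have h2 : ∫⁻ u in Set.Ioi τ, μ.restrict {x | τ < h x} {x | u < h x} ≤
      A * ENNReal.ofReal (τ ^ (1 - σ) / (σ - 1)) := by
    calc _ ≤ ∫⁻ u in Set.Ioi τ, A * ENNReal.ofReal (u ^ (-σ)) := by
          refine setLIntegral_mono' measurableSet_Ioi fun u hu => ?_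
          exact (Measure.restrict_apply_le _ _).trans (hw u (hτ.trans hu))
      _ = _ := by
          rw [lintegral_const_mul _ (by fun_prop), lintegral_Ioi_ofReal_rpow (by linarith) hτ]
          congr 2
          rw [neg_div, ← div_neg]
          congr 1 <;> [congr 1; skip] <;> ring
  refine (add_le_add h1 h2).trans_eq ?_
  rw [← mul_add, ← ENNReal.ofReal_add (by positivity)
    (div_nonneg (by positivity) (by linarith)), mul_assoc, ← ENNReal.ofReal_mul
    (div_nonneg (by linarith) (by linarith))]
  congr 2
  have : σ - 1 ≠ 0 := by linarith
  field_simp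
  ring

/-- A nonnegative function of weak type `σ` is `s`-integrable, `s > σ`, where it is small. -/
theorem setLIntegral_rpow_le_of_weakType {μ : Measure X} {h : X → ℝ} (hm : Measurable h)
    (h0 : ∀ x, 0 ≤ h x) {A : ℝ≥0∞} {σ s : ℝ} (hσ : 0 < σ) (hs : σ < s)
    (hw : ∀ τ, 0 < τ → μ {x | τ < h x} ≤ A * ENNReal.ofReal (τ ^ (-σ))) {τ : ℝ} (hτ : 0 < τ) :
    ∫⁻ x in {x | h x ≤ τ}, ENNReal.ofReal (h x ^ s) ∂μ ≤
      A * ENNReal.ofReal (s / (s - σ)) * ENNReal.ofReal (τ ^ (s - σ)) := by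
  have hs0 : 0 < s := hσ.trans hs
  rw [lintegral_rpow_eq_lintegral_meas_lt_mul _ (.of_forall h0) hm.aemeasurable hs0]
  have h1 : ∫⁻ u in Set.Ioi 0, μ.restrict {x | h x ≤ τ} {x | u < h x} *
      ENNReal.ofReal (u ^ (s - 1)) ≤
      ∫⁻ u in Set.Ioc 0 τ, A * ENNReal.ofReal (u ^ (s - 1 - σ)) := by
    rw [← lintegral_indicator measurableSet_Ioi, ← lintegral_indicator measurableSet_Ioc]
    refine lintegral_mono fun u => ?_
    by_cases hu : 0 < u
    · rw [Set.indicator_of_mem (show u ∈ Set.Ioi 0 from hu)]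
      by_cases huτ : u ≤ τ
      · rw [Set.indicator_of_mem (show u ∈ Set.Ioc 0 τ from ⟨hu, huτ⟩)]
        calc _ ≤ A * ENNReal.ofReal (u ^ (-σ)) * ENNReal.ofReal (u ^ (s - 1)) := by
              gcongr
              exact (Measure.restrict_apply_le _ _).trans (hw u hu)
          _ = _ := by
              rw [mul_assoc, ← ENNReal.ofReal_mul (by positivity), ← Real.rpow_add hu]
              congr 3
              ring
      · have : μ.restrict {x | h x ≤ τ} {x | u < h x} = 0 := by
          rw [Measure.restrict_apply (measurableSet_lt measurable_const hm)]
          convert measure_empty (μ := μ)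
          ext x
          simp only [Set.mem_inter_iff, Set.mem_ofPred_eq, Set.mem_empty_iff_false, iff_false]
          rintro ⟨h1, h2⟩
          linarith
        simp [this]
    · rw [Set.indicator_of_notMem (show u ∉ Set.Ioi 0 from hu)]
      exact zero_le
  calc _ ≤ ENNReal.ofReal s * (A * ENNReal.ofReal (τ ^ (s - σ) / (s - σ))) := by
        gcongr
        refine h1.trans_eq ?_
        rw [lintegral_const_mul _ (by fun_prop),
          lintegral_Ioc_zero_ofReal_rpow (by linarith) hτ.le]
        congr 3 <;> [congr 1; skip] <;> ring
    _ = _ := by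
        rw [mul_left_comm, mul_assoc, ← ENNReal.ofReal_mul hs0.le,
          ← ENNReal.ofReal_mul (div_nonneg hs0.le (by linarith))]
        congr 2
        ring

/-- Pairing of a function of weak type `σ` with the part of an `L^t` function below level `L`. -/
theorem setLIntegral_le_mul_le_of_weakType {μ : Measure X} {h g : X → ℝ} (hm : Measurable h)
    (h0 : ∀ x, 0 ≤ h x) (gm : Measurable g) (g0 : ∀ x, 0 ≤ g x) {A : ℝ≥0∞} {σ t : ℝ}
    (hσ : 1 < σ) (ht : 1 < t) (hσt : σ < t / (t - 1))
    (hw : ∀ τ, 0 < τ → μ {x | τ < h x} ≤ A * ENNReal.ofReal (τ ^ (-σ)))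
    (hg : ∫⁻ x, ENNReal.ofReal (g x ^ t) ∂μ ≤ 1) {L : ℝ} (hL : 0 < L) :
    ∫⁻ x in {x | g x ≤ L}, ENNReal.ofReal (g x * h x) ∂μ ≤
      (1 + A * ENNReal.ofReal (t / (t - 1) / (t / (t - 1) - σ)) +
        A * ENNReal.ofReal (σ / (σ - 1))) * ENNReal.ofReal (L ^ (1 - t * (1 - 1 / σ))) := by
  have ht1 : 0 < t - 1 := by linarith
  have hσ0 : 0 < σ := by linarith
  set s := t / (t - 1) with hs
  have hs1 : s = 1 + 1 / (t - 1) := by rw [hs]; field_simp; ring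
  -- `M` and `τ` are chosen so that the three pieces of the splitting below are all of size `M`: the
  -- curve `h = M g^(t-1)` reaches height `τ` at `g = L`, and `L τ^(1-σ) = M`.
  set M := L ^ (1 - t * (1 - 1 / σ)) with hM
  set τ := L ^ (t / σ) with hτ
  have hM0 : 0 < M := by positivity
  have hτ0 : 0 < τ := by positivity
  have hMτ : M * L ^ (t - 1) = τ := by
    rw [hM, hτ, ← Real.rpow_add hL]; congr 1; ring
  have hLτ : L * τ ^ (1 - σ) = M := by
    rw [hM, hτ, ← Real.rpow_mul hL.le]
    nth_rewrite 1 [← Real.rpow_one L]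
    rw [← Real.rpow_add hL]; congr 1; field_simp; ring
  have hMs : M ^ (-(1 / (t - 1))) * τ ^ (s - σ) = M := by
    rw [hM, hτ, ← Real.rpow_mul hL.le, ← Real.rpow_mul hL.le, ← Real.rpow_add hL]
    congr 1
    rw [hs]; field_simp; ring
  -- Under the curve, `g h ≤ M g^t`. Above it, `g` is at most `(h/M)^(1/(t-1))`, which is used where
  -- `h ≤ τ` and produces the conjugate power `h^s`; where `h > τ` the bound `g ≤ L` is used
  -- instead.
  have pw : ∀ x, g x ≤ L → ENNReal.ofReal (g x * h x) ≤
      ENNReal.ofReal M * ENNReal.ofReal (g x ^ t) +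
      {x | h x ≤ τ}.indicator
        (fun x => ENNReal.ofReal (M ^ (-(1 / (t - 1)))) * ENNReal.ofReal (h x ^ s)) x +
      {x | τ < h x}.indicator (fun x => ENNReal.ofReal L * ENNReal.ofReal (h x)) x := by
    intro x hx
    rcases le_or_gt (h x) (M * g x ^ (t - 1)) with h1 | h1
    · rw [add_assoc]
      refine le_add_right ?_
      rw [← ENNReal.ofReal_mul hM0.le]
      refine ENNReal.ofReal_le_ofReal ?_
      rcases (g0 x).eq_or_lt with h2 | h2
      · rw [← h2, zero_mul]; positivity
      · calc g x * h x ≤ g x * (M * g x ^ (t - 1)) := by gcongr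
          _ = M * (g x ^ (1 : ℝ) * g x ^ (t - 1)) := by rw [Real.rpow_one]; ring
          _ = _ := by rw [← Real.rpow_add h2]; congr 2; ring
    rcases le_or_gt (h x) τ with h2 | h2
    · rw [Set.indicator_of_mem (show x ∈ {x | h x ≤ τ} from h2)]
      refine le_add_right (le_add_left ?_)
      rw [← ENNReal.ofReal_mul (by positivity)]
      refine ENNReal.ofReal_le_ofReal ?_
      have hh : 0 < h x := lt_of_le_of_lt (mul_nonneg hM0.le (Real.rpow_nonneg (g0 x) _)) h1
      have h3 : g x ≤ (h x / M) ^ (1 / (t - 1)) := by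
        rw [one_div, Real.le_rpow_inv_iff_of_pos (g0 x) (by positivity) ht1,
          le_div_iff₀ hM0]
        linarith
      calc g x * h x ≤ (h x / M) ^ (1 / (t - 1)) * h x := by gcongr
        _ = M ^ (-(1 / (t - 1))) * h x ^ s := by
          rw [hs1, Real.rpow_add hh, Real.rpow_one, Real.div_rpow hh.le hM0.le,
            Real.rpow_neg hM0.le]
          ring
    · rw [Set.indicator_of_mem (show x ∈ {x | τ < h x} from h2)]
      refine le_add_left ?_
      rw [← ENNReal.ofReal_mul hL.le]
      exact ENNReal.ofReal_le_ofReal (mul_le_mul_of_nonneg_right hx (h0 x))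
  have hS1 : MeasurableSet {x | h x ≤ τ} := measurableSet_le hm measurable_const
  have hS2 : MeasurableSet {x | τ < h x} := measurableSet_lt measurable_const hm
  calc _ ≤ ∫⁻ x, (ENNReal.ofReal M * ENNReal.ofReal (g x ^ t) +
      {x | h x ≤ τ}.indicator
        (fun x => ENNReal.ofReal (M ^ (-(1 / (t - 1)))) * ENNReal.ofReal (h x ^ s)) x +
      {x | τ < h x}.indicator (fun x => ENNReal.ofReal L * ENNReal.ofReal (h x)) x) ∂μ :=
        (setLIntegral_mono' (measurableSet_le gm measurable_const) pw).trans
          (setLIntegral_le_lintegral _ _)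
    _ = ENNReal.ofReal M * ∫⁻ x, ENNReal.ofReal (g x ^ t) ∂μ +
        ENNReal.ofReal (M ^ (-(1 / (t - 1)))) *
          ∫⁻ x in {x | h x ≤ τ}, ENNReal.ofReal (h x ^ s) ∂μ +
        ENNReal.ofReal L * ∫⁻ x in {x | τ < h x}, ENNReal.ofReal (h x) ∂μ := by
        rw [lintegral_add_right _ (Measurable.indicator (by fun_prop) hS2),
          lintegral_add_right _ (Measurable.indicator (by fun_prop) hS1),
          lintegral_indicator hS1, lintegral_indicator hS2,
          lintegral_const_mul _ (by fun_prop), lintegral_const_mul _ (by fun_prop),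
          lintegral_const_mul _ (by fun_prop)]
    _ ≤ ENNReal.ofReal M * 1 + ENNReal.ofReal (M ^ (-(1 / (t - 1)))) *
          (A * ENNReal.ofReal (s / (s - σ)) * ENNReal.ofReal (τ ^ (s - σ))) +
        ENNReal.ofReal L *
          (A * ENNReal.ofReal (σ / (σ - 1)) * ENNReal.ofReal (τ ^ (1 - σ))) := by
        gcongr
        · exact setLIntegral_rpow_le_of_weakType hm h0 hσ0 hσt hw hτ0
        · exact setLIntegral_gt_le_of_weakType hm h0 hσ hw hτ0
    _ = _ := by
        rw [mul_left_comm (ENNReal.ofReal L), mul_left_comm (ENNReal.ofReal (M ^ _)),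
          ← ENNReal.ofReal_mul (by positivity), ← ENNReal.ofReal_mul hL.le, hMs, hLτ]
        ring

end WeakType

/-! ### Hardy–Littlewood–Sobolev inequality for weak-type kernels, and duality. -/

section Bilinear

variable {X Y : Type*} [MeasurableSpace X] [MeasurableSpace Y]

/-- One half of the splitting. For fixed `x` the level estimate is applied to `f` with `L = g(x)^κ`;
by `hκ` it yields a multiple of `g(x)^(t-1)`, so the outer integrand is a multiple of `g^t`. -/
theorem lintegral_setLIntegral_le_of_weakType {μ : Measure X} {ν : Measure Y}
    {k : X → Y → ℝ} (km : ∀ x, Measurable (k x)) (k0 : ∀ x y, 0 ≤ k x y)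
    {f : Y → ℝ} {g : X → ℝ} (fm : Measurable f) (gm : Measurable g)
    (f0 : ∀ y, 0 ≤ f y) (g0 : ∀ x, 0 ≤ g x) {B : ℝ≥0∞} {ρ p t κ : ℝ}
    (hρ : 1 < ρ) (hp : 1 < p) (hρp : ρ < p / (p - 1))
    (hκ : κ * (1 - p * (1 - 1 / ρ)) = t - 1)
    (hw : ∀ x τ, 0 < τ → ν {y | τ < k x y} ≤ B * ENNReal.ofReal (τ ^ (-ρ)))
    (hf : ∫⁻ y, ENNReal.ofReal (f y ^ p) ∂ν ≤ 1)
    (hg : ∫⁻ x, ENNReal.ofReal (g x ^ t) ∂μ ≤ 1) :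
    ∫⁻ x, ∫⁻ y in {y | f y ≤ g x ^ κ}, ENNReal.ofReal (g x * (f y * k x y)) ∂ν ∂μ ≤
      1 + B * ENNReal.ofReal (p / (p - 1) / (p / (p - 1) - ρ)) +
        B * ENNReal.ofReal (ρ / (ρ - 1)) := by
  set D := 1 + B * ENNReal.ofReal (p / (p - 1) / (p / (p - 1) - ρ)) +
        B * ENNReal.ofReal (ρ / (ρ - 1))
  have pw : ∀ x, ∫⁻ y in {y | f y ≤ g x ^ κ}, ENNReal.ofReal (g x * (f y * k x y)) ∂ν ≤
      D * ENNReal.ofReal (g x ^ t) := by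
    intro x
    rcases (g0 x).eq_or_lt with hx | hx
    · simp [← hx]
    simp_rw [ENNReal.ofReal_mul (g0 x)]
    have km' := km x
    rw [lintegral_const_mul _ (by fun_prop)]
    refine (mul_le_mul_right (setLIntegral_le_mul_le_of_weakType (km x) (k0 x) fm f0 hρ hp hρp
      (hw x) hf (Real.rpow_pos_of_pos hx κ)) _).trans_eq ?_
    rw [mul_left_comm, ← ENNReal.ofReal_mul (g0 x), ← Real.rpow_mul (g0 x), hκ]
    congr 2
    nth_rewrite 1 [← Real.rpow_one (g x)]
    rw [← Real.rpow_add hx]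
    congr 1
    ring
  calc _ ≤ ∫⁻ x, D * ENNReal.ofReal (g x ^ t) ∂μ := lintegral_mono pw
    _ = D * ∫⁻ x, ENNReal.ofReal (g x ^ t) ∂μ := lintegral_const_mul _ (by fun_prop)
    _ ≤ D * 1 := by gcongr
    _ = D := mul_one D

/-- A Hardy–Littlewood–Sobolev inequality for normalized functions and a kernel which is of weak
type `σ` in the first variable and of weak type `ρ` in the second one. -/
theorem exists_lintegral_lintegral_le_of_weakType {μ : Measure X} {ν : Measure Y} [SFinite μ]
    [SFinite ν] {k : X → Y → ℝ} (km : Measurable (Function.uncurry k)) (k0 : ∀ x y, 0 ≤ k x y)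
    {A B : ℝ≥0∞} (hA : A ≠ ∞) (hB : B ≠ ∞) {σ ρ p t : ℝ}
    (hσ : 1 < σ) (hρ : 1 < ρ) (hp : 1 < p) (ht : 1 < t)
    (hσt : σ < t / (t - 1)) (hρp : ρ < p / (p - 1))
    (hbal : (1 - t * (1 - 1 / σ)) * (1 - p * (1 - 1 / ρ)) = (t - 1) * (p - 1))
    (hwx : ∀ y τ, 0 < τ → μ {x | τ < k x y} ≤ A * ENNReal.ofReal (τ ^ (-σ)))
    (hwy : ∀ x τ, 0 < τ → ν {y | τ < k x y} ≤ B * ENNReal.ofReal (τ ^ (-ρ))) :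
    ∃ C : ℝ≥0∞, C ≠ ∞ ∧ ∀ (f : Y → ℝ) (g : X → ℝ), Measurable f → Measurable g →
      (∀ y, 0 ≤ f y) → (∀ x, 0 ≤ g x) → ∫⁻ y, ENNReal.ofReal (f y ^ p) ∂ν ≤ 1 →
      ∫⁻ x, ENNReal.ofReal (g x ^ t) ∂μ ≤ 1 →
      ∫⁻ x, ∫⁻ y, ENNReal.ofReal (g x * (f y * k x y)) ∂ν ∂μ ≤ C := by
  have kx : ∀ x, Measurable (k x) := fun x => km.comp measurable_prodMk_left
  have ky : ∀ y, Measurable fun x => k x y := fun y => km.comp measurable_prodMk_right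
  refine ⟨(1 + B * ENNReal.ofReal (p / (p - 1) / (p / (p - 1) - ρ)) +
      B * ENNReal.ofReal (ρ / (ρ - 1))) +
    (1 + A * ENNReal.ofReal (t / (t - 1) / (t / (t - 1) - σ)) +
      A * ENNReal.ofReal (σ / (σ - 1))), ?_, fun f g fm gm f0 g0 hf hg => ?_⟩
  · simp [ENNReal.mul_eq_top, hA, hB]
  have ha : 0 < 1 - t * (1 - 1 / σ) := by
    have ht1 : 0 < t - 1 := by linarith
    have hσ0 : 0 < σ := by linarith
    rw [lt_div_iff₀ ht1] at hσt
    have : 1 - t * (1 - 1 / σ) = (t - σ * (t - 1)) / σ := by field_simp; ring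
    rw [this]
    exact div_pos (by linarith) hσ0
  set a := 1 - t * (1 - 1 / σ)
  set b := 1 - p * (1 - 1 / ρ)
  -- Forced by the half where `g ≤ f^(1/κ)`, which needs `κ⁻¹ a = p - 1`; the other half needs `κ b
  -- = t - 1`, and `hbal` makes the two agree.
  set κ := a / (p - 1) with hκ
  have hp1 : 0 < p - 1 := by linarith
  have hκ0 : 0 < κ := div_pos ha hp1
  have hκb : κ * b = t - 1 := by rw [hκ]; field_simp; linarith
  have hκa : κ⁻¹ * a = p - 1 := by rw [hκ]; field_simp
  have hS : MeasurableSet {z : X × Y | g z.1 ≤ f z.2 ^ κ⁻¹} :=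
    measurableSet_le (by fun_prop) (by fun_prop)
  have h1 := lintegral_setLIntegral_le_of_weakType kx k0 fm gm f0 g0 hρ hp hρp hκb hwy hf hg
  have h2 := lintegral_setLIntegral_le_of_weakType (k := fun y x => k x y) ky (fun y x => k0 x y)
    gm fm g0 f0 hσ ht hσt hκa hwx hg hf
  refine le_trans ?_ (add_le_add h1 h2)
  have h3 : ∫⁻ y, ∫⁻ x in {x | g x ≤ f y ^ κ⁻¹}, ENNReal.ofReal (f y * (g x * k x y)) ∂μ ∂ν =
      ∫⁻ x, ∫⁻ y, {z : X × Y | g z.1 ≤ f z.2 ^ κ⁻¹}.indicator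
        (fun z => ENNReal.ofReal (g z.1 * (f z.2 * k z.1 z.2))) (x, y) ∂ν ∂μ := by
    rw [lintegral_lintegral_swap]
    · refine lintegral_congr fun y => ?_
      rw [← lintegral_indicator (measurableSet_le gm measurable_const)]
      refine lintegral_congr fun x => ?_
      simp only [Set.indicator, Set.mem_ofPred_eq, mul_left_comm]
    · refine (Measurable.indicator ?_ hS).aemeasurable
      have : Measurable fun z : X × Y => k z.1 z.2 := km
      fun_prop
  rw [h3, ← lintegral_add_right']
  · refine lintegral_mono fun x => ?_
    rw [← lintegral_add_compl _ (measurableSet_le fm (measurable_const (a := g x ^ κ)))]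
    refine add_le_add le_rfl ?_
    rw [← lintegral_indicator (measurableSet_le fm measurable_const).compl]
    refine lintegral_mono fun y => ?_
    by_cases hy : y ∈ {a | f a ≤ g x ^ κ}ᶜ
    swap
    · rw [Set.indicator_of_notMem hy]
      exact zero_le
    have hy' : g x ^ κ < f y := not_le.1 hy
    have : g x ≤ f y ^ κ⁻¹ := by
      rw [Real.le_rpow_inv_iff_of_pos (g0 x) (f0 y) hκ0]; exact hy'.le
    rw [Set.indicator_of_mem hy,
      Set.indicator_of_mem (show (x, y) ∈ {z : X × Y | g z.1 ≤ f z.2 ^ κ⁻¹} from this)]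
  · refine (Measurable.lintegral_prod_right' (Measurable.indicator ?_ hS)).aemeasurable
    have : Measurable fun z : X × Y => k z.1 z.2 := km
    fun_prop

theorem eLpNorm_ofReal_eq {μ : Measure X} {p : ℝ} (hp : 0 < p) (f : X → ℝ) :
    eLpNorm f (ENNReal.ofReal p) μ = (∫⁻ x, ‖f x‖ₑ ^ p ∂μ) ^ (1 / p) := by
  rw [eLpNorm_eq_lintegral_rpow_enorm_toReal (by simpa using hp) ENNReal.ofReal_ne_top,
    ENNReal.toReal_ofReal hp.le]

theorem exists_normalization {μ : Measure X} {p : ℝ} (hp : 1 < p) {f : X → ℝ}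
    (hf : MemLp f (ENNReal.ofReal p) μ) (hne : eLpNorm f (ENNReal.ofReal p) μ ≠ 0) :
    ∃ F : X → ℝ, Measurable F ∧ (∀ x, 0 ≤ F x) ∧ ∫⁻ x, ENNReal.ofReal (F x ^ p) ∂μ ≤ 1 ∧
      ∀ᵐ x ∂μ, ‖f x‖ₑ = eLpNorm f (ENNReal.ofReal p) μ * ENNReal.ofReal (F x) := by
  have hp0 : 0 < p := by linarith
  set N := eLpNorm f (ENNReal.ofReal p) μ with hN
  have hNt : N ≠ ∞ := hf.2.ne
  have hNr : 0 < N.toReal := ENNReal.toReal_pos hne hNt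
  have hm := hf.1.aemeasurable
  have hae : ∀ᵐ x ∂μ, ‖f x‖ₑ = N * ENNReal.ofReal (N.toReal⁻¹ * |hm.mk f x|) := by
    filter_upwards [hm.ae_eq_mk] with x hx
    rw [← hx, ENNReal.ofReal_mul (by positivity), ENNReal.ofReal_inv_of_pos hNr,
      ENNReal.ofReal_toReal hNt, ← mul_assoc, ENNReal.mul_inv_cancel hne hNt, one_mul,
      Real.enorm_eq_ofReal_abs]
  refine ⟨fun x => N.toReal⁻¹ * |hm.mk f x|, by have := hm.measurable_mk; fun_prop,
    fun x => by positivity, ?_, hae⟩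
  -- Both sides are `∫ |f|^p`; cancelling `N ^ p` normalizes `F`.
  have h1 : N ^ p = N ^ p * ∫⁻ x, ENNReal.ofReal ((N.toReal⁻¹ * |hm.mk f x|) ^ p) ∂μ := by
    rw [← lintegral_const_mul' _ _ (ENNReal.rpow_ne_top_of_nonneg hp0.le hNt)]
    nth_rewrite 1 [hN]
    rw [eLpNorm_ofReal_eq hp0, ← ENNReal.rpow_mul, one_div_mul_cancel hp0.ne', ENNReal.rpow_one]
    refine lintegral_congr_ae ?_
    filter_upwards [hae] with x hx
    rw [hx, ENNReal.mul_rpow_of_nonneg _ _ hp0.le,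
      ENNReal.ofReal_rpow_of_nonneg (by positivity) hp0.le]
  refine le_of_eq ?_
  have hpos : N ^ p ≠ 0 := by simp [hne, hp0, hNt]
  have hpt : N ^ p ≠ ∞ := ENNReal.rpow_ne_top_of_nonneg hp0.le hNt
  exact ((ENNReal.mul_right_inj hpos hpt).1 (by rw [mul_one]; exact h1)).symm

/-- A Hardy–Littlewood–Sobolev inequality for a kernel which is of weak type `σ` in the first
variable and of weak type `ρ` in the second one. -/
theorem exists_lintegral_lintegral_le_eLpNorm_mul_eLpNorm {μ : Measure X} {ν : Measure Y}
    [SFinite μ] [SFinite ν] {k : X → Y → ℝ} (km : Measurable (Function.uncurry k))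
    (k0 : ∀ x y, 0 ≤ k x y) {A B : ℝ≥0∞} (hA : A ≠ ∞) (hB : B ≠ ∞) {σ ρ p t : ℝ}
    (hσ : 1 < σ) (hρ : 1 < ρ) (hp : 1 < p) (ht : 1 < t)
    (hσt : σ < t / (t - 1)) (hρp : ρ < p / (p - 1))
    (hbal : (1 - t * (1 - 1 / σ)) * (1 - p * (1 - 1 / ρ)) = (t - 1) * (p - 1))
    (hwx : ∀ y τ, 0 < τ → μ {x | τ < k x y} ≤ A * ENNReal.ofReal (τ ^ (-σ)))
    (hwy : ∀ x τ, 0 < τ → ν {y | τ < k x y} ≤ B * ENNReal.ofReal (τ ^ (-ρ))) :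
    ∃ C : ℝ≥0∞, C ≠ ∞ ∧ ∀ (f : Y → ℝ) (g : X → ℝ), MemLp f (ENNReal.ofReal p) ν →
      MemLp g (ENNReal.ofReal t) μ →
      ∫⁻ x, ‖g x‖ₑ * ∫⁻ y, ‖f y‖ₑ * ENNReal.ofReal (k x y) ∂ν ∂μ ≤
        C * eLpNorm f (ENNReal.ofReal p) ν * eLpNorm g (ENNReal.ofReal t) μ := by
  obtain ⟨C, hC, H⟩ := exists_lintegral_lintegral_le_of_weakType km k0 hA hB hσ hρ hp ht hσt hρp
    hbal hwx hwy
  refine ⟨C, hC, fun f g hf hg => ?_⟩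
  by_cases hfn : eLpNorm f (ENNReal.ofReal p) ν = 0
  · have h0 := (eLpNorm_eq_zero_iff hf.1 (by simp; linarith)).1 hfn
    have : ∀ x, ∫⁻ y, ‖f y‖ₑ * ENNReal.ofReal (k x y) ∂ν = 0 := fun x => by
      rw [lintegral_congr_ae (g := 0) (by filter_upwards [h0] with y hy; simp [hy])]
      simp
    simp [this]
  by_cases hgn : eLpNorm g (ENNReal.ofReal t) μ = 0
  · have h0 := (eLpNorm_eq_zero_iff hg.1 (by simp; linarith)).1 hgn
    rw [lintegral_congr_ae (g := 0) (by filter_upwards [h0] with y hy; simp [hy])]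
    simp
  obtain ⟨F, Fm, F0, FI, hF⟩ := exists_normalization hp hf hfn
  obtain ⟨G, Gm, G0, GI, hG⟩ := exists_normalization ht hg hgn
  have hft : eLpNorm f (ENNReal.ofReal p) ν ≠ ∞ := hf.2.ne
  have hgt : eLpNorm g (ENNReal.ofReal t) μ ≠ ∞ := hg.2.ne
  set N := eLpNorm f (ENNReal.ofReal p) ν
  set N' := eLpNorm g (ENNReal.ofReal t) μ
  have h1 : ∀ᵐ x ∂μ, ‖g x‖ₑ * ∫⁻ y, ‖f y‖ₑ * ENNReal.ofReal (k x y) ∂ν =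
      N * N' * ∫⁻ y, ENNReal.ofReal (G x * (F y * k x y)) ∂ν := by
    filter_upwards [hG] with x hx
    rw [← lintegral_const_mul' _ _ (by simp), ← lintegral_const_mul' _ _ (ENNReal.mul_ne_top hft hgt)]
    refine lintegral_congr_ae ?_
    filter_upwards [hF] with y hy
    rw [hx, hy, ENNReal.ofReal_mul (G0 x), ENNReal.ofReal_mul (F0 y)]
    ring
  rw [lintegral_congr_ae h1, lintegral_const_mul' _ _ (ENNReal.mul_ne_top hft hgt)]
  calc _ ≤ N * N' * C := by gcongr; exact H F G Fm Gm F0 G0 FI GI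
    _ = _ := by ring

/-- Converse of Hölder's inequality. -/
theorem lintegral_rpow_le_of_forall_lintegral_mul_le {μ : Measure X} [SigmaFinite μ]
    {u : X → ℝ≥0∞} (um : AEMeasurable u μ) {t q : ℝ} (htq : t.HolderConjugate q) {C : ℝ≥0∞}
    (H : ∀ g : X → ℝ, MemLp g (ENNReal.ofReal t) μ →
      ∫⁻ x, ‖g x‖ₑ * u x ∂μ ≤ C * eLpNorm g (ENNReal.ofReal t) μ) :
    (∫⁻ x, u x ^ q ∂μ) ^ (1 / q) ≤ C := by
  wlog hm : Measurable u generalizing u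
  · rw [lintegral_congr_ae (g := fun x => um.mk u x ^ q)
      (by filter_upwards [um.ae_eq_mk] with x hx; rw [hx])]
    refine this um.measurable_mk.aemeasurable (fun g hg => ?_) um.measurable_mk
    rw [← lintegral_congr_ae (f := fun x => ‖g x‖ₑ * u x)
      (by filter_upwards [um.ae_eq_mk] with x hx; rw [hx])]
    exact H g hg
  have ht0 : 0 < t := htq.pos
  have hq0 : 0 < q := htq.symm.pos
  have hq1 : 0 < q - 1 := htq.symm.sub_one_pos
  have hqt : (q - 1) * t = q := htq.symm.sub_one_mul_conj
  let S := spanningSets μ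
  -- Truncation in height and in support makes `∫ v^q` finite, so that testing with `v^(q-1)` gives
  -- `I ≤ C I^(1/t)`, in which `I^(1/t)` may be cancelled. Monotone convergence removes the
  -- truncation.
  let v : ℕ → X → ℝ≥0∞ := fun k => (S k).indicator fun x => min (u x) k
  have vm : ∀ k, Measurable (v k) := fun k =>
    (hm.min measurable_const).indicator (measurableSet_spanningSets μ k)
  have vu : ∀ k x, v k x ≤ u x := fun k x =>
    Set.indicator_le_self' (s := S k) (f := fun x => min (u x) k) (fun _ _ => zero_le) x |>.trans
      (min_le_left _ _)
  have vt : ∀ k x, v k x ≠ ∞ := fun k x => by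
    by_cases hx : x ∈ S k <;> simp [v, hx]
  have vI : ∀ k, ∫⁻ x, v k x ^ q ∂μ ≤ C ^ q := by
    intro k
    set I := ∫⁻ x, v k x ^ q ∂μ with hI
    have hIt : I ≠ ∞ := by
      refine ne_of_lt (lt_of_le_of_lt (b := ∫⁻ x in S k, (k : ℝ≥0∞) ^ q ∂μ) ?_ ?_)
      · rw [← lintegral_indicator (measurableSet_spanningSets μ k)]
        refine lintegral_mono fun x => ?_
        by_cases hx : x ∈ S k
        · simp only [v, Set.indicator_of_mem hx]
          rw [Set.indicator_of_mem (show x ∈ spanningSets μ k from hx)]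
          exact ENNReal.rpow_le_rpow (min_le_right _ _) hq0.le
        · simp [v, hx, hq0]
      · rw [setLIntegral_const]
        exact ENNReal.mul_lt_top (ENNReal.rpow_lt_top_of_nonneg hq0.le (by simp))
          (measure_spanningSets_lt_top μ k)
    let g : X → ℝ := fun x => (v k x ^ (q - 1)).toReal
    have hge : ∀ x, ‖g x‖ₑ = v k x ^ (q - 1) := fun x => by
      rw [Real.enorm_of_nonneg ENNReal.toReal_nonneg,
        ENNReal.ofReal_toReal (ENNReal.rpow_ne_top_of_nonneg hq1.le (vt k x))]
    have hgn : eLpNorm g (ENNReal.ofReal t) μ = I ^ (1 / t) := by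
      rw [eLpNorm_ofReal_eq ht0]
      simp_rw [hge, ← ENNReal.rpow_mul, hqt]
      rfl
    have hgL : MemLp g (ENNReal.ofReal t) μ := by
      refine ⟨?_, ?_⟩
      · exact ((vm k).pow_const _).ennreal_toReal.aestronglyMeasurable
      · rw [hgn]
        exact ENNReal.rpow_lt_top_of_nonneg (by positivity) hIt
    have h1 : I ≤ C * I ^ (1 / t) := by
      rw [← hgn]
      refine le_trans (lintegral_mono fun x => ?_) (H g hgL)
      rw [hge]
      calc v k x ^ q = v k x ^ (q - 1) * v k x := by
            nth_rewrite 3 [← ENNReal.rpow_one (v k x)]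
            rw [← ENNReal.rpow_add_of_nonneg _ _ hq1.le zero_le_one, sub_add_cancel]
        _ ≤ _ := by gcongr; exact vu k x
    by_cases hI0 : I = 0
    · rw [hI0]; exact zero_le
    have h2 : I ^ (1 / q) ≤ C := by
      have h3 : I = I ^ (1 / q) * I ^ (1 / t) := by
        rw [← ENNReal.rpow_add _ _ hI0 hIt, one_div, one_div, add_comm, htq.inv_add_inv_eq_one,
          ENNReal.rpow_one]
      exact (ENNReal.mul_le_mul_iff_left (by simp [hI0, hIt])
        (ENNReal.rpow_ne_top_of_nonneg (by positivity) hIt)).1 (h3.symm.trans_le h1)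
    rw [one_div, ENNReal.rpow_inv_le_iff hq0] at h2
    exact h2
  rw [one_div, ENNReal.rpow_inv_le_iff hq0]
  have hmono : Monotone v := by
    intro i j hij x
    by_cases hx : x ∈ S i
    · have hx' : x ∈ S j := monotone_spanningSets μ hij hx
      simp only [v, Set.indicator_of_mem hx, Set.indicator_of_mem hx']
      exact min_le_min_left _ (by exact_mod_cast hij)
    · simp [v, hx]
  have hlim : ∀ x, Filter.Tendsto (fun k => v k x) Filter.atTop (nhds (u x)) := by
    intro x
    obtain ⟨i, hi⟩ : ∃ i, x ∈ S i := 
      Set.mem_iUnion.1 ((iUnion_spanningSets μ).symm ▸ Set.mem_univ x)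
    have h1 : Filter.Tendsto (fun k : ℕ => min (u x) k) Filter.atTop (nhds (min (u x) ∞)) :=
      tendsto_const_nhds.min ENNReal.tendsto_nat_nhds_top
    rw [min_eq_left le_top] at h1
    refine h1.congr' ?_
    filter_upwards [Filter.eventually_ge_atTop i] with k hk
    simp only [v, Set.indicator_of_mem (show x ∈ S k from monotone_spanningSets μ hk hi)]
  refine le_of_tendsto' (lintegral_tendsto_of_tendsto_of_monotone
    (fun k => ((vm k).pow_const q).aemeasurable)
    (.of_forall fun x i j hij => ENNReal.rpow_le_rpow (hmono hij x) hq0.le)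
    (.of_forall fun x => ?_)) vI
  exact ((ENNReal.continuous_rpow_const (y := q)).tendsto _).comp (hlim x)

end Bilinear

/-! ### The half-space kernel: weak-type bounds and exponents. -/

namespace HalfSpaceHLS

theorem continuous_bdist (n : ℕ) :
    Continuous fun z : Ambient n × Boundary n => bdist z.1 z.2 := by
  unfold bdist
  fun_prop

theorem bdist_nonneg {n : ℕ} (x : Ambient n) (y : Boundary n) : 0 ≤ bdist x y :=
  Real.sqrt_nonneg _

theorem norm_sub_le_bdist {n : ℕ} (x : Ambient n) (y : Boundary n) : ‖x.1 - y‖ ≤ bdist x y :=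
  Real.le_sqrt_of_sq_le (by nlinarith [sq_nonneg x.2])

theorem snd_le_bdist {n : ℕ} (x : Ambient n) (y : Boundary n) : x.2 ≤ bdist x y :=
  Real.le_sqrt_of_sq_le (by nlinarith [sq_nonneg ‖x.1 - y‖])

theorem bdist_lt_of_lt_inv_rpow {n : ℕ} {l τ : ℝ} (hl : 0 < l) (hτ : 0 < τ) {x : Ambient n}
    {y : Boundary n} (h : τ < (bdist x y ^ l)⁻¹) : bdist x y < τ ^ (-l⁻¹) := by
  have hb : 0 < bdist x y ^ l := inv_pos.1 (hτ.trans h)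
  have h1 : bdist x y ^ l < τ⁻¹ := (lt_inv_comm₀ hb hτ).2 h
  rw [Real.rpow_neg hτ.le, ← Real.inv_rpow hτ.le]
  exact (Real.lt_rpow_inv_iff_of_pos (bdist_nonneg x y) (by positivity) hl).2 h1

theorem measurable_inv_bdist_rpow (n : ℕ) (l : ℝ) :
    Measurable (Function.uncurry fun (x : Ambient n) (y : Boundary n) => (bdist x y ^ l)⁻¹) := by
  have := (continuous_bdist n).measurable
  unfold Function.uncurry
  fun_prop

/-- The superlevel set lies in a cylinder of radius and height `R = τ^(-1/l)`, whose volume is a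
multiple of `R^(n-1) · R`. -/
theorem halfVol_lt_inv_bdist_le (n : ℕ) (hn : 1 ≤ n) {l : ℝ} (hl : 0 < l) (y : Boundary n)
    (τ : ℝ) (hτ : 0 < τ) :
    halfVol n {x | τ < (bdist x y ^ l)⁻¹} ≤
      volume (Metric.ball (0 : Boundary n) 1) * ENNReal.ofReal (τ ^ (-((n : ℝ) / l))) := by
  set R := τ ^ (-l⁻¹) with hR
  have hR0 : 0 < R := by positivity
  have hsub : {x : Ambient n | τ < (bdist x y ^ l)⁻¹} ∩ halfSpace n ⊆
      Metric.ball y R ×ˢ Set.Ioo 0 R := by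
    rintro x ⟨hx, hx0⟩
    have h1 := bdist_lt_of_lt_inv_rpow hl hτ hx
    refine ⟨?_, hx0, (snd_le_bdist x y).trans_lt h1⟩
    rw [mem_ball_iff_norm]
    exact (norm_sub_le_bdist x y).trans_lt h1
  have hS : MeasurableSet (halfSpace n) := measurableSet_lt measurable_const measurable_snd
  rw [halfVol, Measure.restrict_apply' hS]
  refine (measure_mono hsub).trans_eq ?_
  rw [Measure.volume_eq_prod, Measure.prod_prod, Measure.addHaar_ball_of_pos _ _ hR0,
    Real.volume_Ioo, sub_zero, mul_comm (ENNReal.ofReal _), mul_assoc,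
    ← ENNReal.ofReal_mul (by positivity), finrank_euclideanSpace_fin, ← pow_succ,
    Nat.sub_add_cancel hn, hR, ← Real.rpow_natCast, ← Real.rpow_mul hτ.le]
  congr 3
  ring

theorem volume_lt_inv_bdist_le (n : ℕ) (hn : 1 ≤ n) {l : ℝ} (hl : 0 < l) (x : Ambient n)
    (τ : ℝ) (hτ : 0 < τ) :
    volume {y : Boundary n | τ < (bdist x y ^ l)⁻¹} ≤
      volume (Metric.ball (0 : Boundary n) 1) * ENNReal.ofReal (τ ^ (-(((n : ℝ) - 1) / l))) := by
  set R := τ ^ (-l⁻¹) with hR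
  have hR0 : 0 < R := by positivity
  have hsub : {y : Boundary n | τ < (bdist x y ^ l)⁻¹} ⊆ Metric.ball x.1 R := by
    intro y hy
    rw [mem_ball_iff_norm']
    exact (norm_sub_le_bdist x y).trans_lt (bdist_lt_of_lt_inv_rpow hl hτ hy)
  refine (measure_mono hsub).trans_eq ?_
  rw [Measure.addHaar_ball_of_pos _ _ hR0, mul_comm (ENNReal.ofReal _),
    finrank_euclideanSpace_fin, hR, ← Real.rpow_natCast, ← Real.rpow_mul hτ.le, Nat.cast_sub hn,
    Nat.cast_one]
  congr 3
  ring

section Exponents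

variable {n : ℕ} {α p t : ℝ}

theorem holderConjugate_qExp (hα : 1 < α) (hαn : α < n) (ht : 1 < t)
    (hpt : ((n : ℝ) - 1) / n * (1 / p) + 1 / t + ((n : ℝ) - α + 1) / n = 2) :
    t.HolderConjugate (qExp n α p) := by
  rw [Real.holderConjugate_iff]
  refine ⟨ht, ?_⟩
  have hn : (n : ℝ) ≠ 0 := by linarith
  have hn1 : (n : ℝ) - 1 ≠ 0 := by linarith
  rw [qExp, inv_inv]
  have h1 : ((n : ℝ) - 1) / n * (1 / p - (α - 1) / ((n : ℝ) - 1)) =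
      ((n : ℝ) - 1) / n * (1 / p) - (α - 1) / n := by field_simp
  have h2 : ((n : ℝ) - α + 1) / n = 1 - (α - 1) / n := by field_simp; ring
  rw [h1, ← one_div]
  linarith

theorem exists_lintegral_lintegral_le (hα : 1 < α) (hαn : α < n) (hp : 1 < p) (ht : 1 < t)
    (hpt : ((n : ℝ) - 1) / n * (1 / p) + 1 / t + ((n : ℝ) - α + 1) / n = 2) :
    ∃ C : ℝ≥0∞, C ≠ ∞ ∧ ∀ (f : Boundary n → ℝ) (g : Ambient n → ℝ),
      MemLp f (ENNReal.ofReal p) volume → MemLp g (ENNReal.ofReal t) (halfVol n) →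
      ∫⁻ x, ‖g x‖ₑ *
        (∫⁻ y, ‖f y‖ₑ * ENNReal.ofReal (bdist x y ^ ((n : ℝ) - α))⁻¹) ∂(halfVol n) ≤
        C * eLpNorm f (ENNReal.ofReal p) volume * eLpNorm g (ENNReal.ofReal t) (halfVol n) := by
  have hn1 : 1 ≤ n := by
    have : (1 : ℝ) < n := hα.trans hαn
    exact_mod_cast this.le
  have hl : 0 < (n : ℝ) - α := by linarith
  have hN : (0 : ℝ) < n := by linarith
  have hN1 : 0 < (n : ℝ) - 1 := by linarith
  have hp0 : 0 < p := by linarith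
  have ht0 : 0 < t := by linarith
  -- The exponent relation cleared of denominators; every condition on `σ` and `ρ` involving `p` and
  -- `t` follows from it.
  have key : ((n : ℝ) - 1) * t + n * p = ((n : ℝ) + α - 1) * p * t := by
    field_simp at hpt
    linarith
  have hball : volume (Metric.ball (0 : Boundary n) 1) ≠ ∞ := measure_ball_lt_top.ne
  have : SFinite (halfVol n) := by unfold halfVol; infer_instance
  refine exists_lintegral_lintegral_le_eLpNorm_mul_eLpNorm
    (k := fun x y => (bdist x y ^ ((n : ℝ) - α))⁻¹)
    (measurable_inv_bdist_rpow n _) (fun x y => inv_nonneg.2 (Real.rpow_nonneg (bdist_nonneg x y) _))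
    hball hball (σ := n / (n - α)) (ρ := (n - 1) / (n - α)) ?_ ?_ hp ht ?_ ?_ ?_
    (halfVol_lt_inv_bdist_le n hn1 hl) (volume_lt_inv_bdist_le n hn1 hl)
  · rw [lt_div_iff₀ hl]; linarith
  · rw [lt_div_iff₀ hl]; linarith
  · rw [div_lt_div_iff₀ hl (by linarith)]
    -- By `key` the gap between the two sides is exactly `(n-1)(p-1)t`; in the next condition it is
    -- `n(t-1)p`.
    have h1 : p * (n * (t - 1)) < p * (t * (n - α)) := by
      linarith [mul_pos (mul_pos hN1 (sub_pos.2 hp)) ht0]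
    linarith [lt_of_mul_lt_mul_left h1 hp0.le]
  · rw [div_lt_div_iff₀ hl (by linarith)]
    have h1 : t * ((n - 1) * (p - 1)) < t * (p * (n - α)) := by
      linarith [mul_pos (mul_pos hN hp0) (sub_pos.2 ht)]
    exact lt_of_mul_lt_mul_left h1 ht0.le
  · have e1 : 1 - t * (1 - 1 / ((n : ℝ) / (n - α))) = (n - α * t) / n := by
      field_simp; ring
    have e2 : 1 - p * (1 - 1 / (((n : ℝ) - 1) / (n - α))) = (n - 1 - (α - 1) * p) / (n - 1) := by
      field_simp; ring
    have e3 : p * (n - α * t) = (n - 1) * (p - 1) * t := by linarith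
    have e4 : t * (n - 1 - (α - 1) * p) = n * (t - 1) * p := by linarith
    rw [e1, e2, div_mul_div_comm, div_eq_iff (by positivity)]
    have : (p * t) * ((n - α * t) * (n - 1 - (α - 1) * p)) =
        (p * t) * ((t - 1) * (p - 1) * (n * (n - 1))) := by
      linear_combination (t * (n - 1 - (α - 1) * p)) * e3 + ((n - 1) * (p - 1) * t) * e4
    exact mul_left_cancel₀ (by positivity) this

end Exponents

end HalfSpaceHLS

/-! ### The extension operator, its best constant, and the equivalence of the two inequalities. -/

namespace HalfSpaceHLS

theorem measurableSet_halfSpace (n : ℕ) : MeasurableSet (halfSpace n) :=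
  measurableSet_lt measurable_const measurable_snd

instance sigmaFinite_halfVol (n : ℕ) : SigmaFinite (halfVol n) := by
  unfold halfVol; infer_instance

theorem halfVol_ne_zero (n : ℕ) : halfVol n ≠ 0 := by
  rw [halfVol, Ne, Measure.restrict_eq_zero]
  have ho : IsOpen (halfSpace n) := isOpen_lt continuous_const continuous_snd
  exact (ho.measure_pos _ ⟨(0, 1), by simp [halfSpace]⟩).ne'

theorem enorm_div_bdist_rpow {n : ℕ} (a l : ℝ) (x : Ambient n) (y : Boundary n) :
    ‖a / bdist x y ^ l‖ₑ = ‖a‖ₑ * ENNReal.ofReal (bdist x y ^ l)⁻¹ := by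
  rw [div_eq_mul_inv, enorm_mul,
    Real.enorm_of_nonneg (inv_nonneg.2 (Real.rpow_nonneg (bdist_nonneg x y) l))]

theorem aestronglyMeasurable_div_bdist_rpow {n : ℕ} (μ : Measure (Ambient n)) [SFinite μ] (l : ℝ)
    {f : Boundary n → ℝ} (hf : AEStronglyMeasurable f volume) :
    AEStronglyMeasurable (fun z : Ambient n × Boundary n => f z.2 / bdist z.1 z.2 ^ l)
      (μ.prod volume) :=
  (hf.comp_snd.aemeasurable.div
    ((continuous_bdist n).measurable.pow_const l).aemeasurable).aestronglyMeasurable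

theorem aestronglyMeasurable_extOp {n : ℕ} (α : ℝ) {f : Boundary n → ℝ}
    (hf : AEStronglyMeasurable f volume) : AEStronglyMeasurable (extOp n α f) (halfVol n) :=
  (aestronglyMeasurable_div_bdist_rpow (halfVol n) ((n : ℝ) - α) hf).integral_prod_right'

theorem extOp_congr {n : ℕ} (α : ℝ) {f g : Boundary n → ℝ} (h : f =ᵐ[volume] g) :
    extOp n α f = extOp n α g := by
  funext x
  refine integral_congr_ae ?_
  filter_upwards [h] with y hy
  rw [hy]

theorem extOp_const_mul {n : ℕ} (α c : ℝ) (f : Boundary n → ℝ) :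
    extOp n α (fun y => c * f y) = fun x => c * extOp n α f x := by
  funext x
  simp_rw [extOp, mul_div_assoc]
  exact integral_const_mul _ _

theorem integral_mul_div_bdist_rpow {n : ℕ} (α : ℝ) (f : Boundary n → ℝ) (g : Ambient n → ℝ)
    (x : Ambient n) :
    ∫ y, g x * f y / bdist x y ^ ((n : ℝ) - α) = g x * extOp n α f x := by
  simp_rw [extOp, mul_div_assoc]
  exact integral_const_mul _ _

/-- The defining property of the best constant, without normalization. -/
theorem eLpNorm_extOp_le_Ce_mul {n : ℕ} {α p : ℝ} (hp : 1 < p) {f : Boundary n → ℝ}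
    (hf : MemLp f (ENNReal.ofReal p) volume) :
    eLpNorm (extOp n α f) (ENNReal.ofReal (qExp n α p)) (halfVol n) ≤
      Ce n α p * eLpNorm f (ENNReal.ofReal p) volume := by
  set N := eLpNorm f (ENNReal.ofReal p) volume with hN
  by_cases h0 : N = 0
  · have h1 := (eLpNorm_eq_zero_iff hf.1 (by simp; linarith)).1 h0
    rw [extOp_congr α h1]
    have : extOp n α (0 : Boundary n → ℝ) = 0 := by
      funext x; simp [extOp]
    rw [this, eLpNorm_zero]
    exact zero_le
  have hNt : N ≠ ∞ := hf.2.ne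
  have hNr : 0 < N.toReal := ENNReal.toReal_pos h0 hNt
  have hce : ‖N.toReal⁻¹‖ₑ = N⁻¹ := by
    rw [Real.enorm_of_nonneg (by positivity), ENNReal.ofReal_inv_of_pos hNr,
      ENNReal.ofReal_toReal hNt]
  have hle : ‖N.toReal⁻¹‖ₑ * eLpNorm (extOp n α f) (ENNReal.ofReal (qExp n α p)) (halfVol n) ≤
      Ce n α p := by
    refine le_sSup ⟨fun y => N.toReal⁻¹ * f y, hf.const_mul _, ?_, ?_⟩
    · change eLpNorm (N.toReal⁻¹ • f) _ _ = 1
      rw [eLpNorm_const_smul, hce, ← hN, ENNReal.inv_mul_cancel h0 hNt]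
    · rw [extOp_const_mul, ← eLpNorm_const_smul]
      rfl
  rw [hce] at hle
  calc _ = N * (N⁻¹ * eLpNorm (extOp n α f) (ENNReal.ofReal (qExp n α p)) (halfVol n)) := by
        rw [← mul_assoc, ENNReal.mul_inv_cancel h0 hNt, one_mul]
    _ ≤ N * Ce n α p := by gcongr
    _ = _ := mul_comm _ _

theorem Ce_le {n : ℕ} {α p : ℝ} {C : ℝ≥0∞}
    (h : ∀ f : Boundary n → ℝ, MemLp f (ENNReal.ofReal p) volume →
      eLpNorm (extOp n α f) (ENNReal.ofReal (qExp n α p)) (halfVol n) ≤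
        C * eLpNorm f (ENNReal.ofReal p) volume) : Ce n α p ≤ C := by
  refine sSup_le ?_
  rintro c ⟨f, hf, hf1, rfl⟩
  simpa [hf1] using h f hf

theorem integral_indicator_closedBall_div_pos {d : ℕ} {c : EuclideanSpace ℝ (Fin d) → ℝ}
    (hc : Continuous c) (hc0 : ∀ y, 0 < c y) :
    0 < ∫ y, (Metric.closedBall (0 : EuclideanSpace ℝ (Fin d)) 1).indicator (fun _ => 1) y / c y := by
  have hpos : ∀ y, 0 < (c y)⁻¹ := fun y => inv_pos.2 (hc0 y)
  have h1 : ∀ y, (Metric.closedBall (0 : EuclideanSpace ℝ (Fin d)) 1).indicator (fun _ => 1) y / c y =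
      (Metric.closedBall (0 : EuclideanSpace ℝ (Fin d)) 1).indicator (fun y => (c y)⁻¹) y := by
    intro y
    by_cases hy : y ∈ Metric.closedBall (0 : EuclideanSpace ℝ (Fin d)) 1
    · rw [Set.indicator_of_mem hy, Set.indicator_of_mem hy, one_div]
    · rw [Set.indicator_of_notMem hy, Set.indicator_of_notMem hy, zero_div]
  have hcont : Continuous fun y => (c y)⁻¹ := hc.inv₀ fun y => (hc0 y).ne'
  rw [integral_congr_ae (.of_forall h1), integral_indicator measurableSet_closedBall,
    setIntegral_pos_iff_support_of_nonneg_ae (.of_forall fun y => (hpos y).le)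
    (hcont.continuousOn.integrableOn_compact (isCompact_closedBall _ _))]
  have : Function.support (fun y => (c y)⁻¹) = Set.univ :=
    Set.eq_univ_of_forall fun y => (hpos y).ne'
  rw [this, Set.univ_inter]
  exact Metric.measure_closedBall_pos _ _ one_pos

theorem extOp_indicator_closedBall_pos {n : ℕ} (α : ℝ) {x : Ambient n} (hx : x ∈ halfSpace n) :
    0 < extOp n α ((Metric.closedBall (0 : Boundary n) 1).indicator fun _ => 1) x := by
  have hx0 : 0 < x.2 := hx
  have hb : ∀ y : Boundary n, 0 < bdist x y := fun y => hx0.trans_le (snd_le_bdist x y)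
  have hc : Continuous fun y : Boundary n => bdist x y := by
    unfold bdist
    fun_prop
  exact integral_indicator_closedBall_div_pos (hc.rpow_const fun y => Or.inl (hb y).ne')
    fun y => Real.rpow_pos_of_pos (hb y) _

/-- If the constant vanished, `E_α` of the indicator of a ball would be zero almost everywhere, yet
it is strictly positive on the whole half space. -/
theorem Ce_pos {n : ℕ} {α p : ℝ} (hp : 1 < p) (hq : 0 < qExp n α p) : 0 < Ce n α p := by
  rw [pos_iff_ne_zero]
  intro h0
  set f : Boundary n → ℝ := (Metric.closedBall (0 : Boundary n) 1).indicator fun _ => 1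
  have hf : MemLp f (ENNReal.ofReal p) volume :=
    memLp_indicator_const _ measurableSet_closedBall 1 (Or.inr measure_closedBall_lt_top.ne)
  have h1 := eLpNorm_extOp_le_Ce_mul (α := α) hp hf
  rw [h0, zero_mul, nonpos_iff_eq_zero,
    eLpNorm_eq_zero_iff (aestronglyMeasurable_extOp α hf.1) (by simpa using hq)] at h1
  refine halfVol_ne_zero n (ae_eq_bot.1 (Filter.empty_mem_iff_bot.1 ?_))
  have h2 : ∀ᵐ x ∂(halfVol n), x ∈ halfSpace n := ae_restrict_mem (measurableSet_halfSpace n)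
  change ∀ᵐ x ∂(halfVol n), False
  filter_upwards [h1, h2] with x hx hx'
  exact (extOp_indicator_closedBall_pos α hx').ne' hx

/-- `|E_α f|` is dominated by the integral of `|f|` against the kernel, whose `L^q` norm is
controlled by the converse of Hölder's inequality. -/
theorem exists_eLpNorm_extOp_le {n : ℕ} {α p t : ℝ} (hα : 1 < α) (hαn : α < n) (hp : 1 < p)
    (ht : 1 < t)
    (hpt : ((n : ℝ) - 1) / n * (1 / p) + 1 / t + ((n : ℝ) - α + 1) / n = 2) :
    ∃ C : ℝ≥0∞, C ≠ ∞ ∧ ∀ f : Boundary n → ℝ, MemLp f (ENNReal.ofReal p) volume →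
      eLpNorm (extOp n α f) (ENNReal.ofReal (qExp n α p)) (halfVol n) ≤
        C * eLpNorm f (ENNReal.ofReal p) volume := by
  obtain ⟨C, hC, H⟩ := exists_lintegral_lintegral_le hα hαn hp ht hpt
  have htq := holderConjugate_qExp hα hαn ht hpt
  refine ⟨C, hC, fun f hf => ?_⟩
  rw [eLpNorm_ofReal_eq htq.symm.pos]
  have hm := (aestronglyMeasurable_div_bdist_rpow (halfVol n) ((n : ℝ) - α) hf.1).enorm
  simp only [enorm_div_bdist_rpow] at hm
  refine le_trans ?_ (lintegral_rpow_le_of_forall_lintegral_mul_le hm.lintegral_prod_right' htq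
    (H f · hf))
  gcongr with x
  · exact one_div_nonneg.2 htq.symm.nonneg
  · exact htq.symm.nonneg
  refine (enorm_integral_le_lintegral_enorm _).trans_eq ?_
  simp only [enorm_div_bdist_rpow]

theorem integrable_mul_div_bdist_rpow {n : ℕ} {α p t : ℝ} (hα : 1 < α) (hαn : α < n) (hp : 1 < p)
    (ht : 1 < t)
    (hpt : ((n : ℝ) - 1) / n * (1 / p) + 1 / t + ((n : ℝ) - α + 1) / n = 2)
    {f : Boundary n → ℝ} {g : Ambient n → ℝ} (hf : MemLp f (ENNReal.ofReal p) volume)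
    (hg : MemLp g (ENNReal.ofReal t) (halfVol n)) :
    Integrable (fun z : Ambient n × Boundary n => g z.1 * f z.2 / bdist z.1 z.2 ^ ((n : ℝ) - α))
      ((halfVol n).prod volume) := by
  obtain ⟨C, hC, H⟩ := exists_lintegral_lintegral_le hα hαn hp ht hpt
  have hm : AEStronglyMeasurable
      (fun z : Ambient n × Boundary n => g z.1 * f z.2 / bdist z.1 z.2 ^ ((n : ℝ) - α))
      ((halfVol n).prod volume) := by
    simp_rw [mul_div_assoc]
    exact hg.1.comp_fst.mul (aestronglyMeasurable_div_bdist_rpow (halfVol n) _ hf.1)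
  refine ⟨hm, ?_⟩
  rw [HasFiniteIntegral, lintegral_prod _ hm.enorm]
  refine lt_of_le_of_lt ?_ (ENNReal.mul_lt_top (ENNReal.mul_lt_top hC.lt_top hf.2) hg.2)
  refine le_trans (lintegral_mono fun x => ?_) (H f g hf hg)
  simp only [enorm_div_bdist_rpow, enorm_mul, mul_assoc]
  exact (lintegral_const_mul' _ _ (by simp)).le

theorem lintegral_enorm_mul_le_eLpNorm_mul_eLpNorm {X : Type*} [MeasurableSpace X] {μ : Measure X}
    {t q : ℝ} (htq : t.HolderConjugate q) {g h : X → ℝ} (hg : AEStronglyMeasurable g μ)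
    (hh : AEStronglyMeasurable h μ) :
    ∫⁻ x, ‖g x * h x‖ₑ ∂μ ≤ eLpNorm g (ENNReal.ofReal t) μ * eLpNorm h (ENNReal.ofReal q) μ := by
  rw [eLpNorm_ofReal_eq htq.pos, eLpNorm_ofReal_eq htq.symm.pos]
  simp_rw [enorm_mul]
  exact ENNReal.lintegral_mul_le_Lp_mul_Lq μ htq hg.enorm hh.enorm

theorem BilinearHLS.of_extensionHLS {n : ℕ} {α p t C : ℝ} (htq : t.HolderConjugate (qExp n α p))
    (hC : 0 ≤ C) (h : ExtensionHLS n α p C) : BilinearHLS n α p t C := by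
  intro f g hf hg
  simp_rw [integral_mul_div_bdist_rpow]
  have h1 := (lintegral_enorm_mul_le_eLpNorm_mul_eLpNorm htq hg.1
    (aestronglyMeasurable_extOp α hf.1)).trans (mul_le_mul_right (h f hf) _)
  have h2 := ENNReal.toReal_mono
    (ENNReal.mul_ne_top hg.2.ne (ENNReal.mul_ne_top ENNReal.ofReal_ne_top hf.2.ne))
    ((enorm_integral_le_lintegral_enorm _).trans h1)
  rw [ENNReal.toReal_mul, ENNReal.toReal_mul, ENNReal.toReal_ofReal hC, toReal_enorm] at h2
  exact (Real.le_norm_self _).trans (h2.trans_eq (mul_comm _ _))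

/-- The extremal function in Hölder's inequality for a given `h ∈ L^q`. -/
theorem exists_memLp_integral_mul_eq {X : Type*} [MeasurableSpace X] {μ : Measure X} {t q : ℝ}
    (htq : t.HolderConjugate q) {h : X → ℝ} (hh : MemLp h (ENNReal.ofReal q) μ) :
    ∃ g : X → ℝ, MemLp g (ENNReal.ofReal t) μ ∧
      eLpNorm g (ENNReal.ofReal t) μ = eLpNorm h (ENNReal.ofReal q) μ ^ (q - 1) ∧
      ∫ x, g x * h x ∂μ = (eLpNorm h (ENNReal.ofReal q) μ).toReal ^ q := by
  have hq0 : 0 < q := htq.symm.pos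
  have hq1 : 0 < q - 1 := htq.symm.sub_one_pos
  have hqt : (q - 1) * t = q := htq.symm.sub_one_mul_conj
  have hge : ∀ x, ‖h x * |h x| ^ (q - 2)‖ₑ = ‖h x‖ₑ ^ (q - 1) := by
    intro x
    -- Zeros are treated apart because `q - 2` may be negative.
    by_cases hx : h x = 0
    · simp [hx, hq1]
    have hx' : 0 < |h x| := abs_pos.2 hx
    rw [← ofReal_norm, norm_mul, Real.norm_eq_abs, Real.norm_of_nonneg (by positivity),
      Real.enorm_eq_ofReal_abs, ENNReal.ofReal_rpow_of_pos hx']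
    congr 1
    nth_rewrite 1 [← Real.rpow_one |h x|]
    rw [← Real.rpow_add hx']
    congr 1
    ring
  have hgn : eLpNorm (fun x => h x * |h x| ^ (q - 2)) (ENNReal.ofReal t) μ =
      eLpNorm h (ENNReal.ofReal q) μ ^ (q - 1) := by
    rw [eLpNorm_ofReal_eq htq.pos, eLpNorm_ofReal_eq hq0, ← ENNReal.rpow_mul]
    simp_rw [hge, ← ENNReal.rpow_mul, hqt]
    congr 1
    rw [div_mul_eq_mul_div, one_mul, div_eq_div_iff htq.pos.ne' hq0.ne']
    linarith
  refine ⟨fun x => h x * |h x| ^ (q - 2), ⟨?_, ?_⟩, hgn, ?_⟩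
  · have := hh.1.aemeasurable
    exact (this.mul (this.abs.pow_const _)).aestronglyMeasurable
  · rw [hgn]
    exact ENNReal.rpow_lt_top_of_nonneg hq1.le hh.2.ne
  · have hpt : ∀ x, h x * |h x| ^ (q - 2) * h x = |h x| ^ q := by
      intro x
      by_cases hx : h x = 0
      · simp [hx, hq0.ne']
      have hx' : 0 < |h x| := abs_pos.2 hx
      calc h x * |h x| ^ (q - 2) * h x = |h x| ^ (q - 2) * |h x| ^ 2 := by rw [sq_abs]; ring
        _ = |h x| ^ q := by
          rw [← Real.rpow_natCast, ← Real.rpow_add hx']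
          congr 1
          push_cast
          ring
    simp_rw [hpt]
    rw [integral_eq_lintegral_of_nonneg_ae (.of_forall fun x => by positivity)
      (hh.1.aemeasurable.abs.pow_const _).aestronglyMeasurable, ENNReal.toReal_rpow,
      eLpNorm_ofReal_eq hq0, ← ENNReal.rpow_mul, one_div_mul_cancel hq0.ne', ENNReal.rpow_one]
    congr 1
    refine lintegral_congr fun x => ?_
    rw [Real.enorm_eq_ofReal_abs, ENNReal.ofReal_rpow_of_nonneg (abs_nonneg _) hq0.le]

/-- Testing with the Hölder extremal of `E_α f` gives `N^q ≤ C ‖f‖ N^(q-1)` for `N = ‖E_α f‖_q`.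
Cancelling requires `N < ∞`, which is why the qualitative bound `hfin` is supplied. -/
theorem ExtensionHLS.of_bilinearHLS {n : ℕ} {α p t C : ℝ} (htq : t.HolderConjugate (qExp n α p))
    (hfin : ∀ f : Boundary n → ℝ, MemLp f (ENNReal.ofReal p) volume →
      eLpNorm (extOp n α f) (ENNReal.ofReal (qExp n α p)) (halfVol n) < ∞)
    (hC : 0 ≤ C) (h : BilinearHLS n α p t C) : ExtensionHLS n α p C := by
  intro f hf
  set q := qExp n α p
  obtain ⟨g, hg, hgn, hgi⟩ := exists_memLp_integral_mul_eq htq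
    ⟨aestronglyMeasurable_extOp α hf.1, hfin f hf⟩
  have h1 := h f g hf hg
  simp_rw [integral_mul_div_bdist_rpow] at h1
  rw [hgi, hgn, ← ENNReal.toReal_rpow] at h1
  have hNt := (hfin f hf).ne
  set N := eLpNorm (extOp n α f) (ENNReal.ofReal q) (halfVol n)
  rcases eq_or_ne N 0 with h0 | h0
  · rw [h0]; exact zero_le
  have hNr : 0 < N.toReal := ENNReal.toReal_pos h0 hNt
  have h2 : N.toReal ^ q = N.toReal * N.toReal ^ (q - 1) := by
    nth_rewrite 2 [← Real.rpow_one N.toReal]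
    rw [← Real.rpow_add hNr]
    congr 1
    ring
  rw [h2] at h1
  have h3 := le_of_mul_le_mul_right h1 (Real.rpow_pos_of_pos hNr _)
  rw [← ENNReal.ofReal_toReal hNt, ← ENNReal.ofReal_toReal hf.2.ne, ← ENNReal.ofReal_mul hC]
  exact ENNReal.ofReal_le_ofReal h3

theorem BilinearHLS.mono {n : ℕ} {α p t C D : ℝ} (hCD : C ≤ D) (h : BilinearHLS n α p t C) :
    BilinearHLS n α p t D := fun f g hf hg =>
  (h f g hf hg).trans (by gcongr)

end HalfSpaceHLS

theorem theorem1p2 (n : ℕ) (α p t : ℝ) (hα : 1 < α) (hαn : α < n)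
    (hp : 1 < p) (ht : 1 < t)
    (hpt : ((n : ℝ) - 1) / n * (1 / p) + 1 / t + ((n : ℝ) - α + 1) / n = 2) :
    -- the best constant is positive and finite
    0 < HalfSpaceHLS.Ce n α p ∧ HalfSpaceHLS.Ce n α p < ∞ ∧
    -- the double integral converges absolutely
    (∀ (f : HalfSpaceHLS.Boundary n → ℝ) (g : HalfSpaceHLS.Ambient n → ℝ),
      MemLp f (ENNReal.ofReal p) volume →
      MemLp g (ENNReal.ofReal t) (HalfSpaceHLS.halfVol n) →
      Integrable
        (fun z : HalfSpaceHLS.Ambient n × HalfSpaceHLS.Boundary n =>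
          g z.1 * f z.2 / HalfSpaceHLS.bdist z.1 z.2 ^ ((n : ℝ) - α))
        ((HalfSpaceHLS.halfVol n).prod volume)) ∧
    -- the bilinear inequality holds with the constant `C_e(n, α, p)`
    HalfSpaceHLS.BilinearHLS n α p t (HalfSpaceHLS.Ce n α p).toReal ∧
    -- it is sharp: no smaller constant works
    (∀ C : ℝ, HalfSpaceHLS.BilinearHLS n α p t C →
      (HalfSpaceHLS.Ce n α p).toReal ≤ C) ∧
    -- it is equivalent to the inequality for the extension operator, with the same constant
    (∀ C : ℝ, 0 ≤ C →
      (HalfSpaceHLS.BilinearHLS n α p t C ↔ HalfSpaceHLS.ExtensionHLS n α p C)) := by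
  have htq := HalfSpaceHLS.holderConjugate_qExp hα hαn ht hpt
  obtain ⟨C₀, hC₀, H⟩ := HalfSpaceHLS.exists_eLpNorm_extOp_le hα hαn hp ht hpt
  have hCt : HalfSpaceHLS.Ce n α p < ∞ := (HalfSpaceHLS.Ce_le H).trans_lt hC₀.lt_top
  have hCpos : 0 < HalfSpaceHLS.Ce n α p := HalfSpaceHLS.Ce_pos hp htq.symm.pos
  have hiff : ∀ C : ℝ, 0 ≤ C →
      (HalfSpaceHLS.BilinearHLS n α p t C ↔ HalfSpaceHLS.ExtensionHLS n α p C) := fun C hC =>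
    ⟨.of_bilinearHLS htq (fun f hf => (H f hf).trans_lt (ENNReal.mul_lt_top hC₀.lt_top hf.2)) hC,
      .of_extensionHLS htq hC⟩
  have hsharp : ∀ C : ℝ, 0 ≤ C → HalfSpaceHLS.BilinearHLS n α p t C →
      (HalfSpaceHLS.Ce n α p).toReal ≤ C := fun C hC h =>
    ENNReal.toReal_le_of_le_ofReal hC (HalfSpaceHLS.Ce_le ((hiff C hC).1 h))
  refine ⟨hCpos, hCt, fun f g => HalfSpaceHLS.integrable_mul_div_bdist_rpow hα hαn hp ht hpt,
    (hiff _ ENNReal.toReal_nonneg).2 fun f hf => ?_, fun C h => ?_, hiff⟩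
  · rw [ENNReal.ofReal_toReal hCt.ne]
    exact HalfSpaceHLS.eLpNorm_extOp_le_Ce_mul hp hf
  -- A negative constant would imply the inequality with constant `0`, hence `Ce ≤ 0`, against
  -- positivity.
  · rcases le_or_gt 0 C with hC | hC
    · exact hsharp C hC h
    · exact absurd (hsharp 0 le_rfl (h.mono hC.le)) (ENNReal.toReal_pos hCpos.ne' hCt.ne).not_ge
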